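/- Let $k\ge 1$ be an integer, $\lambda>0$, $\mathbb{R}_+=(0,\infty)$ and $\mathbf 1=(1,\dots,1)\in\mathbb{R}^k$. Let $g:\mathbb{R}_+^k\to\mathbb{R}$ be a generalized tempered Hermite kernel, that is, a nonzero measurable function such that (H1) $g(c\mathbf x)=c^{\alpha}g(\mathbf x)$ for all $c>0$, $\mathbf x\in\mathbb{R}_+^k$, where $\alpha\in\left(-\frac{k+1}{2},-\frac{k}{2}\right)$; (H2) $\int_{\mathbb{R}_+^k}|g(\mathbf x)\,g(\mathbf 1+\mathbf x)|\prod_{i=1}^k e^{-2\lambda u x_i}\,d\mathbf x<\infty$ for all $u\ge 0$. Let $W$ be a real Gaussian white noise on $\mathbb{R}$ (an isonormal Gaussian process over $L^2(\mathbb{R})$) on a probability space, let $I_k$ be the $k$-fold multiple Wiener–Itô integral with respect to $W$, and for $t\in\mathbb{R}$ put $$h_t^{\lambda}(\mathbf x)=\int_0^t g(s\mathbf 1-\mathbf x)\prod_{i=1}^k e^{-\lambda(s-x_i)}\,1_{\{s>x_1,\dots,s>x_k\}}\,ds,\qquad Z^{\lambda}(t)=I_k(h_t^{\lambda}).$$ Then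 $Z^{\lambda}$ is well defined, i.e. for every $t\in\mathbb{R}$ the integral defining $h_t^{\lambda}(\mathbf x)$ converges absolutely for a.e. $\mathbf x\in\mathbb{R}^k$ and $h_t^{\lambda}\in L^2(\mathbb{R}^k)$. With $H=\alpha+1+\frac k2\in(\frac12,1)$ there is a constant $C$ such that $$E\left|Z^{\lambda}(t)-Z^{\lambda}(s)\right|^2\le C|t-s|^{2H}\qquad\text{for all } s,t\in\mathbb{R},$$ and $Z^{\lambda}$ has a continuous version: there is a process $(Y(t))_{t\in\mathbb{R}}$, all of whose paths are continuous, such that $Y(t)=Z^{\lambda}(t)$ almost surely for every $t\in\mathbb{R}$. -/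

import Mathlib

open MeasureTheory ProbabilityTheory Set
open scoped ENNReal RealInnerProductSpace

noncomputable section

namespace TemperedHermite

/-! ### White noise on the real line -/

/-- A real white noise on `ℝ` (isonormal Gaussian process over `L²(ℝ, dx)`): a centred Gaussian
family `(W φ)` indexed by `φ ∈ L²(ℝ)` with `E[W φ * W ψ] = ⟪φ, ψ⟫`.  For a Borel set `A` of finite
measure, `W(1_A)` is the Gaussian random measure `W(A)` of `A`. -/
structure IsWhiteNoise {Ω : Type*} [MeasurableSpace Ω]
    (W : Lp ℝ 2 (volume : Measure ℝ) → Ω → ℝ) (P : Measure Ω) : Prop where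
  gaussian : IsGaussianProcess W P
  centered : ∀ φ, ∫ ω, W φ ω ∂P = 0
  covariance : ∀ φ ψ, ∫ ω, W φ ω * W ψ ω ∂P = ⟪φ, ψ⟫

/-! ### Multiple Wiener-Itô integrals -/

/-- Measurable boxes `A₁ × ⋯ × A_k ⊆ ℝ^k` whose sides are pairwise disjoint Borel sets of finite
Lebesgue measure. -/
structure OffDiagBox (k : ℕ) where
  side : Fin k → Set ℝ
  measurableSet : ∀ i, MeasurableSet (side i)
  volume_ne_top : ∀ i, volume (side i) ≠ ∞
  disjoint : Pairwise (Function.onFun Disjoint side)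

namespace OffDiagBox

variable {k : ℕ}

/-- The box itself, as a subset of `ℝ^k`. -/
def toSet (A : OffDiagBox k) : Set (Fin k → ℝ) := Set.univ.pi A.side

theorem measurableSet_toSet (A : OffDiagBox k) : MeasurableSet A.toSet :=
  MeasurableSet.univ_pi A.measurableSet

theorem volume_toSet_ne_top (A : OffDiagBox k) : volume A.toSet ≠ ∞ := by
  rw [toSet, volume_pi_pi]
  exact ENNReal.prod_ne_top fun i _ => A.volume_ne_top i

/-- The indicator function of the box in `L²(ℝ^k)`. -/
def indicator (A : OffDiagBox k) : Lp ℝ 2 (volume : Measure (Fin k → ℝ)) :=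
  indicatorConstLp 2 A.measurableSet_toSet A.volume_toSet_ne_top 1

/-- The indicator function of the `i`-th side of the box in `L²(ℝ)`. -/
def sideIndicator (A : OffDiagBox k) (i : Fin k) : Lp ℝ 2 (volume : Measure ℝ) :=
  indicatorConstLp 2 (A.measurableSet i) (A.volume_ne_top i) 1

end OffDiagBox

section

variable {Ω : Type*} [MeasurableSpace Ω] {P : Measure Ω}
  {W : Lp ℝ 2 (volume : Measure ℝ) → Ω → ℝ} {k : ℕ}

theorem IsWhiteNoise.memLp_prod (hW : IsWhiteNoise W P) {ι : Type*} (s : Finset ι)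
    (φ : ι → Lp ℝ 2 (volume : Measure ℝ)) {p : ℝ≥0∞} (hp : p ≠ ∞) :
    MemLp (fun ω => ∏ i ∈ s, W (φ i) ω) p P := by
  have := hW.gaussian.isProbabilityMeasure
  rcases s.eq_empty_or_nonempty with rfl | hs
  · simpa using memLp_const (1 : ℝ)
  · have hc : (s.card : ℝ≥0∞) ≠ 0 := by simpa using hs.ne_empty
    have h := MemLp.prod' (s := s) (p := fun _ => s.card * p) (μ := P)
      (f := fun i => W (φ i)) (fun i _ =>
        (hW.gaussian.hasGaussianLaw_eval (φ i)).memLp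
          (ENNReal.mul_ne_top (ENNReal.natCast_ne_top _) hp))
    have e : (∑ i ∈ s, ((s.card : ℝ≥0∞) * p)⁻¹)⁻¹ = p := by
      rw [Finset.sum_const, nsmul_eq_mul,
        ENNReal.mul_inv (Or.inl hc) (Or.inl (ENNReal.natCast_ne_top _)), inv_inv,
        ← mul_assoc,
        ENNReal.inv_mul_cancel hc (ENNReal.natCast_ne_top _), one_mul]
    rwa [e] at h

/-- The multiple integral `W(A₁) ⋯ W(A_k) ∈ L²(P)` of the indicator of an off-diagonal box. -/
def boxIntegral (hW : IsWhiteNoise W P) (A : OffDiagBox k) : Lp ℝ 2 P :=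
  (hW.memLp_prod Finset.univ A.sideIndicator (p := 2) (by simp)).toLp

theorem IsWhiteNoise.integrable_prod (hW : IsWhiteNoise W P) {ι : Type*} (s : Finset ι)
    (φ : ι → Lp ℝ 2 (volume : Measure ℝ)) : Integrable (fun ω => ∏ i ∈ s, W (φ i) ω) P :=
  memLp_one_iff_integrable.1 (hW.memLp_prod s φ (by simp))

theorem IsWhiteNoise.integrable_mul (hW : IsWhiteNoise W P)
    (φ ψ : Lp ℝ 2 (volume : Measure ℝ)) : Integrable (fun ω => W φ ω * W ψ ω) P := by
  simpa using hW.integrable_prod Finset.univ ![φ, ψ]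

theorem IsWhiteNoise.ae_eq_sum (hW : IsWhiteNoise W P) {ι : Type*} (s : Finset ι)
    (φ : Lp ℝ 2 (volume : Measure ℝ)) (ψ : ι → Lp ℝ 2 (volume : Measure ℝ))
    (h : φ = ∑ c ∈ s, ψ c) : W φ =ᵐ[P] fun ω => ∑ c ∈ s, W (ψ c) ω := by
  have hi : ∀ a b, Integrable (fun ω => W a ω * W b ω) P := hW.integrable_mul
  have e : ∀ ω, (W φ ω - ∑ c ∈ s, W (ψ c) ω) ^ 2 =
      W φ ω * W φ ω - 2 * ∑ c ∈ s, W φ ω * W (ψ c) ω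
        + ∑ c ∈ s, ∑ d ∈ s, W (ψ c) ω * W (ψ d) ω := by
    intro ω
    rw [← Finset.mul_sum, ← Finset.sum_mul_sum]; ring
  have i1 : Integrable (fun ω => W φ ω * W φ ω - 2 * ∑ c ∈ s, W φ ω * W (ψ c) ω) P :=
    (hi _ _).sub ((integrable_finsetSum _ fun c _ => hi _ _).const_mul 2)
  have i2 : Integrable (fun ω => ∑ c ∈ s, ∑ d ∈ s, W (ψ c) ω * W (ψ d) ω) P :=
    integrable_finsetSum _ fun c _ => integrable_finsetSum _ fun d _ => hi _ _
  have hz : ∫ ω, (W φ ω - ∑ c ∈ s, W (ψ c) ω) ^ 2 ∂P = 0 := by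
    simp_rw [e]
    rw [integral_add i1 i2, integral_sub (hi _ _)
      ((integrable_finsetSum _ fun c _ => hi _ _).const_mul 2), integral_const_mul,
      integral_finsetSum _ fun c _ => hi _ _,
      integral_finsetSum _ fun c _ => integrable_finsetSum _ fun d _ => hi _ _]
    simp_rw [integral_finsetSum _ fun d _ => hi _ _, hW.covariance, ← inner_sum, ← sum_inner,
      ← h]
    ring
  rw [integral_eq_zero_iff_of_nonneg (fun ω => sq_nonneg _) (by simp_rw [e]; exact i1.add i2)] at hz
  filter_upwards [hz] with ω hω
  have : W φ ω - ∑ c ∈ s, W (ψ c) ω = 0 := by simpa using hω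
  linarith

theorem IsWhiteNoise.integral_prod_mul_prod (hW : IsWhiteNoise W P) {ι : Type*} [Fintype ι]
    [DecidableEq ι] (ψ : ι → Lp ℝ 2 (volume : Measure ℝ))
    (h : ∀ c d, c ≠ d → ⟪ψ c, ψ d⟫ = 0) (S T : Finset ι) :
    ∫ ω, (∏ c ∈ S, W (ψ c) ω) * ∏ c ∈ T, W (ψ c) ω ∂P =
      if S = T then ∏ c ∈ S, ⟪ψ c, ψ c⟫ else 0 := by
  have := hW.gaussian.isProbabilityMeasure
  have hg := (hW.gaussian.comp_right ψ)
  have hm : ∀ c, AEMeasurable (W (ψ c)) P := fun c => hW.gaussian.aemeasurable _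
  have hind : iIndepFun (fun c => W (ψ c)) P := by
    refine HasGaussianLaw.iIndepFun_of_covariance_eq_zero ?_ ?_
    · exact (hg.hasGaussianLaw Finset.univ).map
        (ContinuousLinearMap.pi fun c => .proj (⟨c, Finset.mem_univ c⟩ : {x // x ∈ Finset.univ}))
    · intro c d hcd
      rw [covariance_eq_sub (hW.gaussian.hasGaussianLaw_eval _).memLp_two
        (hW.gaussian.hasGaussianLaw_eval _).memLp_two, hW.centered, zero_mul, sub_zero]
      exact (hW.covariance _ _).trans (h c d hcd)
  have e : ∀ ω, (∏ c ∈ S, W (ψ c) ω) * ∏ c ∈ T, W (ψ c) ω =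
      ∏ c, ((fun x : ℝ => (if c ∈ S then x else 1) * (if c ∈ T then x else 1)) (W (ψ c) ω)) := by
    intro ω
    simp only [Finset.prod_mul_distrib, Finset.prod_ite_mem, Finset.univ_inter]
  simp_rw [e]
  rw [hind.integral_fun_prod_comp (f := fun c => fun x : ℝ =>
    (if c ∈ S then x else 1) * (if c ∈ T then x else 1)) hm]
  · split_ifs with hST
    · subst hST
      rw [← Finset.univ_inter S, ← Finset.prod_ite_mem]
      refine Finset.prod_congr rfl fun c _ => ?_
      by_cases hc : c ∈ S
      · simp [hc, hW.covariance]
      · simp [hc]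
    · obtain ⟨c, hc⟩ : ∃ c, ¬ (c ∈ S ↔ c ∈ T) := by
        by_contra! hh; exact hST (Finset.ext hh)
      refine Finset.prod_eq_zero (Finset.mem_univ c) ?_
      by_cases h1 : c ∈ S <;> by_cases h2 : c ∈ T <;> simp_all [hW.centered]
  · intro c
    refine Measurable.aestronglyMeasurable ?_
    split_ifs <;> fun_prop

theorem indicatorConstLp_eq_sum {ι : Type*} [Fintype ι] {s : Set ℝ} {t : ι → Set ℝ}
    (hs : MeasurableSet s) (hs' : volume s ≠ ∞) (ht : ∀ i, MeasurableSet (t i))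
    (ht' : ∀ i, volume (t i) ≠ ∞) (hd : Pairwise (Function.onFun Disjoint t))
    (h : s = ⋃ i, t i) :
    indicatorConstLp 2 hs hs' (1 : ℝ) = ∑ i, indicatorConstLp 2 (ht i) (ht' i) (1 : ℝ) := by
  refine ext_inner_right ℝ fun f => ?_
  rw [sum_inner, L2.inner_indicatorConstLp_one]
  simp_rw [L2.inner_indicatorConstLp_one]
  subst h
  exact integral_iUnion_fintype ht hd fun i =>
    integrableOn_Lp_of_measure_ne_top f fact_one_le_two_ennreal.elim (ht' i)

/-- `none` indexes the complement of all sides. -/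
def OffDiagBox.part (A : OffDiagBox k) : Option (Fin k) → Set ℝ
  | none => (⋃ i, A.side i)ᶜ
  | some i => A.side i

theorem OffDiagBox.measurableSet_part (A : OffDiagBox k) (o) : MeasurableSet (A.part o) := by
  cases o
  · exact (MeasurableSet.iUnion A.measurableSet).compl
  · exact A.measurableSet _

theorem OffDiagBox.disjoint_part (A : OffDiagBox k) : Pairwise (Function.onFun Disjoint A.part) := by
  have h : ∀ i, Disjoint (A.side i) (⋃ i, A.side i)ᶜ := fun i =>
    disjoint_compl_right_iff_subset.2 (subset_iUnion _ i)
  rintro (_ | i) (_ | j) hij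
  · exact absurd rfl hij
  · exact (h j).symm
  · exact h i
  · exact A.disjoint (fun e => hij (by rw [e]))

theorem OffDiagBox.iUnion_part (A : OffDiagBox k) : ⋃ o, A.part o = univ := by
  rw [iUnion_option]
  exact compl_union_self _

/-- Common refinement of two families of sides. -/
def OffDiagBox.cell (A B : OffDiagBox k) (c : Option (Fin k) × Option (Fin k)) : Set ℝ :=
  A.part c.1 ∩ B.part c.2 ∩ ((⋃ i, A.side i) ∪ ⋃ i, B.side i)

theorem OffDiagBox.measurableSet_cell (A B : OffDiagBox k) (c) : MeasurableSet (A.cell B c) :=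
  ((A.measurableSet_part _).inter (B.measurableSet_part _)).inter
    ((MeasurableSet.iUnion A.measurableSet).union (MeasurableSet.iUnion B.measurableSet))

theorem OffDiagBox.volume_cell_ne_top (A B : OffDiagBox k) (c) : volume (A.cell B c) ≠ ∞ := by
  refine measure_ne_top_of_subset inter_subset_right (measure_union_ne_top ?_ ?_)
  · exact ((measure_iUnion_fintype_le _ _).trans_lt
      (ENNReal.sum_lt_top.2 fun i _ => (A.volume_ne_top i).lt_top)).ne
  · exact ((measure_iUnion_fintype_le _ _).trans_lt
      (ENNReal.sum_lt_top.2 fun i _ => (B.volume_ne_top i).lt_top)).ne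

theorem OffDiagBox.disjoint_cell (A B : OffDiagBox k) :
    Pairwise (Function.onFun Disjoint (A.cell B)) := by
  rintro ⟨a, b⟩ ⟨c, d⟩ h
  by_cases hac : a = c
  · have hbd : b ≠ d := fun e => h (by rw [hac, e])
    exact (B.disjoint_part hbd).mono (fun x hx => hx.1.2) (fun x hx => hx.1.2)
  · exact (A.disjoint_part hac).mono (fun x hx => hx.1.1) (fun x hx => hx.1.1)

theorem OffDiagBox.side_eq_left (A B : OffDiagBox k) (i) :
    A.side i = ⋃ o, A.cell B (some i, o) := by
  ext x
  have h : ∃ o, x ∈ B.part o := mem_iUnion.1 (B.iUnion_part ▸ mem_univ x)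
  simp only [cell, mem_iUnion, mem_inter_iff, mem_union, part]
  constructor
  · intro hx
    obtain ⟨o, ho⟩ := h
    exact ⟨o, ⟨hx, ho⟩, Or.inl ⟨i, hx⟩⟩
  · rintro ⟨o, h, -⟩; exact h.1

theorem OffDiagBox.side_eq_right (A B : OffDiagBox k) (j) :
    B.side j = ⋃ o, A.cell B (o, some j) := by
  ext x
  have h : ∃ o, x ∈ A.part o := mem_iUnion.1 (A.iUnion_part ▸ mem_univ x)
  simp only [cell, mem_iUnion, mem_inter_iff, mem_union, part]
  constructor
  · intro hx
    obtain ⟨o, ho⟩ := h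
    exact ⟨o, ⟨ho, hx⟩, Or.inr ⟨j, hx⟩⟩
  · rintro ⟨o, h, -⟩; exact h.2

theorem OffDiagBox.cell_some_some (A B : OffDiagBox k) (i j) :
    A.cell B (some i, some j) = A.side i ∩ B.side j := by
  ext x
  simp only [cell, mem_iUnion, mem_inter_iff, mem_union, part]
  exact ⟨fun h => h.1, fun h => ⟨h, Or.inl ⟨i, h.1⟩⟩⟩

theorem IsWhiteNoise.wick (hW : IsWhiteNoise W P) (A B : OffDiagBox k) :
    ∫ ω, (∏ i, W (A.sideIndicator i) ω) * ∏ j, W (B.sideIndicator j) ω ∂P =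
      ∑ σ : Equiv.Perm (Fin k), ∏ i, volume.real (A.side i ∩ B.side (σ i)) := by
  classical
  set ψ : Option (Fin k) × Option (Fin k) → Lp ℝ 2 (volume : Measure ℝ) := fun c =>
    indicatorConstLp 2 (A.measurableSet_cell B c) (A.volume_cell_ne_top B c) 1 with hψ
  have hin : ∀ c d, ⟪ψ c, ψ d⟫ = volume.real (A.cell B c ∩ A.cell B d) := fun c d =>
    L2.real_inner_indicatorConstLp_one_indicatorConstLp_one _ _ _ _
  have horth : ∀ c d, c ≠ d → ⟪ψ c, ψ d⟫ = 0 := by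
    intro c d hcd
    rw [hin, (A.disjoint_cell B hcd).inter_eq]; simp
  have hA : ∀ i, W (A.sideIndicator i) =ᵐ[P] fun ω => ∑ o, W (ψ (some i, o)) ω := fun i =>
    hW.ae_eq_sum _ _ _ (indicatorConstLp_eq_sum _ _ _ _
      (fun _ _ hab => A.disjoint_cell B (by simpa using hab)) (A.side_eq_left B i))
  have hB : ∀ i, W (B.sideIndicator i) =ᵐ[P] fun ω => ∑ o, W (ψ (o, some i)) ω := fun i =>
    hW.ae_eq_sum _ _ _ (indicatorConstLp_eq_sum _ _ _ _
      (fun _ _ hab => A.disjoint_cell B (by simpa using hab)) (A.side_eq_right B i))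
  let gl : (Fin k → Option (Fin k)) → Finset (Option (Fin k) × Option (Fin k)) := fun p =>
    Finset.univ.image fun i => (some i, p i)
  let gr : (Fin k → Option (Fin k)) → Finset (Option (Fin k) × Option (Fin k)) := fun q =>
    Finset.univ.image fun i => (q i, some i)
  have hl : ∀ p (f : _ → ℝ), ∏ c ∈ gl p, f c = ∏ i, f (some i, p i) := fun p f =>
    Finset.prod_image (by intro a _ b _ h; simpa using (Prod.ext_iff.1 h).1)
  have hr : ∀ q (f : _ → ℝ), ∏ c ∈ gr q, f c = ∏ i, f (q i, some i) := fun p f =>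
    Finset.prod_image (by intro a _ b _ h; simpa using (Prod.ext_iff.1 h).2)
  have e1 : (fun ω => (∏ i, W (A.sideIndicator i) ω) * ∏ j, W (B.sideIndicator j) ω) =ᵐ[P]
      fun ω => ∑ p : (Fin k → Option (Fin k)) × (Fin k → Option (Fin k)),
        (∏ c ∈ gl p.1, W (ψ c) ω) * ∏ c ∈ gr p.2, W (ψ c) ω := by
    filter_upwards [ae_all_iff.2 hA, ae_all_iff.2 hB] with ω h1 h2
    simp_rw [h1, h2, hl, hr, Finset.prod_univ_sum, Fintype.piFinset_univ,
      Finset.sum_mul_sum, Fintype.sum_prod_type]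
  have hint : ∀ S T : Finset (Option (Fin k) × Option (Fin k)),
      Integrable (fun ω => (∏ c ∈ S, W (ψ c) ω) * ∏ c ∈ T, W (ψ c) ω) P := fun S T =>
    (hW.memLp_prod S ψ (p := 2) (by simp)).integrable_mul (hW.memLp_prod T ψ (p := 2) (by simp))
  rw [integral_congr_ae e1, integral_finsetSum _ fun p _ => hint _ _]
  simp_rw [hW.integral_prod_mul_prod ψ horth, hl]
  symm
  refine Finset.sum_of_injOn
    (fun σ : Equiv.Perm (Fin k) => ((fun i => some (σ i)), fun j => some (σ.symm j)))
    ?_ (by intro _ _; simp) ?_ ?_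
  · intro σ _ τ _ h
    ext i
    have := congrFun (Prod.ext_iff.1 h).1 i
    simp only [Option.some.injEq] at this
    rw [this]
  · rintro ⟨p, q⟩ - hpq
    rw [if_neg]
    intro h
    apply hpq
    have hex : ∀ i, ∃ j, p i = some j ∧ q j = some i := by
      intro i
      have : (some i, p i) ∈ gr q := h ▸ Finset.mem_image_of_mem _ (Finset.mem_univ i)
      obtain ⟨j, -, hj⟩ := Finset.mem_image.1 this
      exact ⟨j, (Prod.ext_iff.1 hj).2.symm, (Prod.ext_iff.1 hj).1⟩
    choose σ h1 h2 using hex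
    have hinj : Function.Injective σ := by
      intro a b hab
      have := h2 a
      rw [hab, h2 b] at this
      simpa using this.symm
    refine ⟨Equiv.ofBijective σ (Finite.injective_iff_bijective.1 hinj), by simp, ?_⟩
    refine Prod.ext (funext fun i => (h1 i).symm) (funext fun j => ?_)
    obtain ⟨i, rfl⟩ := (Finite.injective_iff_bijective.1 hinj).2 j
    change some _ = q (σ i)
    rw [h2 i]
    congr 1
    exact Equiv.ofBijective_symm_apply_apply _ _ _
  · intro σ _
    have : gl (fun i => some (σ i)) = gr fun j => some (σ.symm j) := by
      ext c
      simp only [gl, gr, Finset.mem_image, Finset.mem_univ, true_and]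
      constructor
      · rintro ⟨i, rfl⟩; exact ⟨σ i, by simp⟩
      · rintro ⟨i, rfl⟩; exact ⟨σ.symm i, by simp⟩
    simp only [this, if_true, hin, inter_self, OffDiagBox.cell_some_some]

/-- Permutation of the sides of a box. -/
def OffDiagBox.perm (A : OffDiagBox k) (σ : Equiv.Perm (Fin k)) : OffDiagBox k where
  side i := A.side (σ i)
  measurableSet _ := A.measurableSet _
  volume_ne_top _ := A.volume_ne_top _
  disjoint _ _ h := A.disjoint (fun e => h (σ.injective e))

theorem OffDiagBox.inner_indicator (A B : OffDiagBox k) :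
    ⟪A.indicator, B.indicator⟫ = ∏ i, volume.real (A.side i ∩ B.side i) := by
  rw [indicator, indicator, L2.real_inner_indicatorConstLp_one_indicatorConstLp_one A.measurableSet_toSet
      B.measurableSet_toSet A.volume_toSet_ne_top B.volume_toSet_ne_top, toSet, toSet,
    ← pi_inter_distrib, measureReal_def, volume_pi_pi, ENNReal.toReal_prod]
  rfl

theorem OffDiagBox.inner_indicator_perm (A B : OffDiagBox k) (σ : Equiv.Perm (Fin k)) :
    ⟪(A.perm σ).indicator, (B.perm σ).indicator⟫ = ⟪A.indicator, B.indicator⟫ := by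
  rw [inner_indicator, inner_indicator]
  exact Equiv.prod_comp σ fun i => volume.real (A.side i ∩ B.side i)

theorem inner_boxIntegral (hW : IsWhiteNoise W P) (A B : OffDiagBox k) :
    ⟪boxIntegral hW A, boxIntegral hW B⟫ =
      ∑ σ : Equiv.Perm (Fin k), ⟪A.indicator, (B.perm σ).indicator⟫ := by
  simp_rw [OffDiagBox.inner_indicator]
  refine Eq.trans ?_ (hW.wick A B)
  rw [L2.inner_def]
  refine integral_congr_ae ?_
  filter_upwards [MemLp.coeFn_toLp (hW.memLp_prod Finset.univ A.sideIndicator (p := 2) (by simp)),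
    MemLp.coeFn_toLp (hW.memLp_prod Finset.univ B.sideIndicator (p := 2) (by simp))] with ω h1 h2
  rw [boxIntegral, boxIntegral, h1, h2]
  simp [mul_comm]

/-- Finite linear combinations of indicators of off-diagonal boxes. -/
def simpleFun (k : ℕ) : (OffDiagBox k →₀ ℝ) →ₗ[ℝ] Lp ℝ 2 (volume : Measure (Fin k → ℝ)) :=
  Finsupp.linearCombination ℝ OffDiagBox.indicator

/-- The multiple integral of off-diagonal simple functions. -/
def simpleIntegral (hW : IsWhiteNoise W P) (k : ℕ) : (OffDiagBox k →₀ ℝ) →ₗ[ℝ] Lp ℝ 2 P :=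
  Finsupp.linearCombination ℝ (boxIntegral hW)

theorem norm_simpleIntegral_le (hW : IsWhiteNoise W P) (d : OffDiagBox k →₀ ℝ) :
    ‖simpleIntegral hW k d‖ ≤ √(k.factorial) * ‖simpleFun k d‖ := by
  let E : Equiv.Perm (Fin k) → Lp ℝ 2 (volume : Measure (Fin k → ℝ)) := fun σ =>
    d.sum fun B b => b • (B.perm σ).indicator
  have hE : ∀ σ, ‖E σ‖ ^ 2 = ‖simpleFun k d‖ ^ 2 := by
    intro σ
    rw [← real_inner_self_eq_norm_sq, ← real_inner_self_eq_norm_sq]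
    simp only [E, simpleFun, Finsupp.linearCombination_apply, Finsupp.sum, sum_inner, inner_sum,
      real_inner_smul_left, real_inner_smul_right, OffDiagBox.inner_indicator_perm]
  have hE' : ∀ σ, ‖E σ‖ = ‖simpleFun k d‖ := fun σ =>
    (sq_eq_sq₀ (norm_nonneg _) (norm_nonneg _)).1 (hE σ)
  have key : ‖simpleIntegral hW k d‖ ^ 2 = ∑ σ, ⟪simpleFun k d, E σ⟫ := by
    rw [← real_inner_self_eq_norm_sq]
    simp only [E, simpleIntegral, simpleFun, Finsupp.linearCombination_apply, Finsupp.sum,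
      sum_inner, inner_sum, real_inner_smul_left, real_inner_smul_right, inner_boxIntegral,
      Finset.mul_sum]
    symm
    rw [Finset.sum_comm]
    exact Finset.sum_congr rfl fun x _ => Finset.sum_comm
  refine le_of_sq_le_sq ?_ (by positivity)
  rw [key, mul_pow, Real.sq_sqrt (by positivity)]
  calc ∑ σ, ⟪simpleFun k d, E σ⟫ ≤ ∑ _σ : Equiv.Perm (Fin k), ‖simpleFun k d‖ ^ 2 := by
        refine Finset.sum_le_sum fun σ _ => (real_inner_le_norm _ _).trans ?_
        rw [hE', sq]
    _ = k.factorial * ‖simpleFun k d‖ ^ 2 := by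
        rw [Finset.sum_const, nsmul_eq_mul, Finset.card_univ, Fintype.card_perm, Fintype.card_fin]

theorem volume_not_injective (k : ℕ) :
    volume {x : Fin k → ℝ | ¬ Function.Injective x} = 0 := by
  have hs : {x : Fin k → ℝ | ¬ Function.Injective x} ⊆
      ⋃ p : {p : Fin k × Fin k // p.1 ≠ p.2}, {x | x p.1.1 = x p.1.2} := by
    intro x hx
    simp only [Function.Injective, mem_ofPred_eq, not_forall] at hx
    obtain ⟨i, j, h, hij⟩ := hx
    exact mem_iUnion.2 ⟨⟨(i, j), hij⟩, h⟩
  refine measure_mono_null hs (measure_iUnion_null ?_)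
  rintro ⟨⟨i, j⟩, hij⟩
  let L : (Fin k → ℝ) →ₗ[ℝ] ℝ := LinearMap.proj (R := ℝ) (φ := fun _ => ℝ) i - LinearMap.proj (R := ℝ) (φ := fun _ => ℝ) j
  have : {x : Fin k → ℝ | x i = x j} = (LinearMap.ker L : Set (Fin k → ℝ)) := by
    ext x; simp [L, sub_eq_zero]
  change volume {x : Fin k → ℝ | x i = x j} = 0
  rw [this]
  refine Measure.addHaar_submodule _ _ fun h => ?_
  have h1 : L (Pi.single i 1) = 0 := by
    have : (Pi.single i 1 : Fin k → ℝ) ∈ LinearMap.ker L := h ▸ Submodule.mem_top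
    simpa using this
  have hij' : j ≠ i := fun e => hij e.symm
  simp [L, hij'] at h1

/-- A grid box. -/
def gridBox (n : ℕ) (m : Fin k → ℤ) (hm : Function.Injective m) : OffDiagBox k where
  side i := {y | ⌊((n : ℝ) + 1) * y⌋ = m i}
  measurableSet i := (Int.measurable_floor.comp (measurable_const_mul _)) (measurableSet_singleton _)
  volume_ne_top i := by
    have hsub : {y : ℝ | ⌊((n : ℝ) + 1) * y⌋ = m i} ⊆
        Icc (m i / ((n : ℝ) + 1)) ((m i + 1) / ((n : ℝ) + 1)) := by
      intro y hy
      have h := Int.floor_eq_iff.1 hy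
      have hn : (0 : ℝ) < n + 1 := by positivity
      exact ⟨by rw [div_le_iff₀ hn]; linarith [h.1], by rw [le_div_iff₀ hn]; linarith [h.2]⟩
    exact ((measure_mono hsub).trans_lt measure_Icc_lt_top).ne
  disjoint _ _ h := by
    refine Set.disjoint_left.2 fun y h1 h2 => h (hm ?_)
    exact h1.symm.trans h2

theorem exists_gridBox {x : Fin k → ℝ} (hx : Function.Injective x) :
    ∃ n m, ∃ hm : Function.Injective m, x ∈ (gridBox n m hm).toSet := by
  have : ∀ᶠ n : ℕ in Filter.atTop, ∀ i j, i ≠ j → 1 ≤ ((n : ℝ) + 1) * |x i - x j| := by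
    simp only [Filter.eventually_all]
    intro i j hij
    have hp : 0 < |x i - x j| := abs_pos.2 (sub_ne_zero.2 (hx.ne hij))
    have ht : Filter.Tendsto (fun n : ℕ => ((n : ℝ) + 1) * |x i - x j|) Filter.atTop
        Filter.atTop :=
      (Filter.tendsto_atTop_add_const_right _ _ tendsto_natCast_atTop_atTop).atTop_mul_const hp
    exact ht.eventually_ge_atTop 1
  obtain ⟨n, hn⟩ := this.exists
  refine ⟨n, fun i => ⌊((n : ℝ) + 1) * x i⌋, ?_, fun i _ => rfl⟩
  intro i j hij
  by_contra hne
  have h1 := Int.abs_sub_lt_one_of_floor_eq_floor hij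
  rw [← mul_sub, abs_mul, abs_of_pos (by positivity : (0 : ℝ) < n + 1)] at h1
  exact absurd (hn i j hne) (not_le.2 h1)

theorem denseRange_simpleFun (k : ℕ) : DenseRange (simpleFun k) := by
  have hcl : (LinearMap.range (simpleFun k)).topologicalClosure = ⊤ := by
    rw [Submodule.topologicalClosure_eq_top_iff, Submodule.eq_bot_iff]
    intro f hf
    have hbox : ∀ A : OffDiagBox k, ∫ x in A.toSet, f x = 0 := by
      intro A
      rw [← L2.inner_indicatorConstLp_one A.measurableSet_toSet A.volume_toSet_ne_top f]
      refine hf _ ⟨Finsupp.single A 1, ?_⟩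
      simp [simpleFun, OffDiagBox.indicator]
    have hQ : ∀ A : OffDiagBox k, ∀ᵐ x, x ∈ A.toSet → f x = 0 := by
      intro A
      have hfi : IntegrableOn f A.toSet volume :=
        integrableOn_Lp_of_measure_ne_top f fact_one_le_two_ennreal.elim A.volume_toSet_ne_top
      rw [← ae_restrict_iff' A.measurableSet_toSet]
      have hz : ∀ s, MeasurableSet s → ∫ x in s, f x ∂(volume.restrict A.toSet) = 0 := by
        refine MeasurableSpace.induction_on_inter generateFrom_pi.symm isPiSystem_pi (by simp)
          ?_ ?_ ?_
        · rintro _ ⟨t, ht, rfl⟩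
          have ht' : ∀ i, MeasurableSet (t i) := fun i => ht i (mem_univ i)
          rw [Measure.restrict_restrict (MeasurableSet.univ_pi ht')]
          have := hbox ⟨fun i => t i ∩ A.side i, fun i => (ht' i).inter (A.measurableSet i),
            fun i => measure_ne_top_of_subset inter_subset_right (A.volume_ne_top i),
            fun i j h => (A.disjoint h).mono inter_subset_right inter_subset_right⟩
          rwa [OffDiagBox.toSet, pi_inter_distrib] at this
        · intro t ht h
          have h0 : ∫ x, f x ∂(volume.restrict A.toSet) = 0 := hbox A
          rw [← integral_add_compl ht hfi, h, zero_add] at h0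
          exact h0
        · intro g hd hm h
          rw [integral_iUnion hm hd hfi.integrableOn]
          simp [h]
      exact hfi.ae_eq_zero_of_forall_setIntegral_eq_zero fun s hs _ => hz s hs
    have hall : ∀ᵐ x, ∀ n : ℕ, ∀ m : {m : Fin k → ℤ // Function.Injective m},
        x ∈ (gridBox n m.1 m.2).toSet → f x = 0 := by
      rw [ae_all_iff]; intro n
      rw [ae_all_iff]; intro m
      exact hQ _
    have hinj : ∀ᵐ x : Fin k → ℝ, Function.Injective x := volume_not_injective k
    refine Lp.ext ?_
    filter_upwards [hall, hinj, Lp.coeFn_zero ℝ 2 (volume : Measure (Fin k → ℝ))] with x h1 h2 h3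
    obtain ⟨n, m, hm, hx⟩ := exists_gridBox h2
    rw [h1 n ⟨m, hm⟩ hx, h3]; rfl
  intro f
  have : f ∈ (LinearMap.range (simpleFun k)).topologicalClosure := hcl ▸ Submodule.mem_top
  exact this

/-- The `k`-fold multiple Wiener-Itô integral `I_k : L²(ℝ^k) → L²(P)` (diagonals excluded): the
continuous linear extension to `L²(ℝ^k)` of the integral of off-diagonal simple functions.  The
extension exists and is unique by `denseRange_simpleFun` and `norm_simpleIntegral_le`. -/
def multipleIntegral (hW : IsWhiteNoise W P) (k : ℕ) :
    Lp ℝ 2 (volume : Measure (Fin k → ℝ)) →L[ℝ] Lp ℝ 2 P :=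
  (simpleIntegral hW k).extendOfNorm (simpleFun k)

theorem multipleIntegral_indicator (hW : IsWhiteNoise W P) (A : OffDiagBox k) :
    multipleIntegral hW k A.indicator = boxIntegral hW A := by
  have := LinearMap.extendOfNorm_eq (f := simpleIntegral hW k) (denseRange_simpleFun k)
    ⟨_, norm_simpleIntegral_le hW⟩ (Finsupp.single A 1)
  simpa [multipleIntegral, simpleFun, simpleIntegral] using this

theorem norm_multipleIntegral_le (hW : IsWhiteNoise W P)
    (f : Lp ℝ 2 (volume : Measure (Fin k → ℝ))) :
    ‖multipleIntegral hW k f‖ ≤ √(k.factorial) * ‖f‖ :=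
  LinearMap.norm_extendOfNorm_apply_le (denseRange_simpleFun k) _ (norm_simpleIntegral_le hW) f

/-! ### The tempered generalized Hermite process -/

/-- The open positive orthant `ℝ_+^k`. -/
def positiveOrthant (k : ℕ) : Set (Fin k → ℝ) := {x | ∀ i, 0 < x i}

/-- Generalized tempered Hermite kernels on `ℝ_+^k`, with homogeneity exponent `α` and tempering
parameter `lam`.  Only the values of `g` on the positive orthant matter. -/
structure IsTemperedHermiteKernel (α lam : ℝ) (g : (Fin k → ℝ) → ℝ) : Prop where
  measurable : Measurable ((positiveOrthant k).domRestrict g)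
  nonzero : ∃ x ∈ positiveOrthant k, g x ≠ 0
  alpha_mem : α ∈ Ioo (-((k : ℝ) + 1) / 2) (-(k : ℝ) / 2)
  homogeneous : ∀ c : ℝ, 0 < c → ∀ x ∈ positiveOrthant k, g (c • x) = c ^ α * g x
  integrable : ∀ u : ℝ, 0 ≤ u →
    IntegrableOn (fun x => |g x * g (1 + x)| * ∏ i, Real.exp (-2 * lam * u * x i))
      (positiveOrthant k) volume

/-- The integrand `s ↦ g(s𝟏 - x) e^{-lam(s𝟏 - x)} 1_{s𝟏 > x}` of the tempered kernel. -/
def temperedIntegrand (lam : ℝ) (g : (Fin k → ℝ) → ℝ) (x : Fin k → ℝ) : ℝ → ℝ :=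
  {s : ℝ | ∀ i, x i < s}.indicator
    fun s => g (fun i => s - x i) * ∏ i, Real.exp (-lam * (s - x i))

/-- The kernel `h_t(x) = ∫₀ᵗ g(s𝟏 - x) e^{-lam(s𝟏 - x)} 1_{s𝟏 > x} ds`. -/
def temperedKernel (lam : ℝ) (g : (Fin k → ℝ) → ℝ) (t : ℝ) (x : Fin k → ℝ) : ℝ :=
  ∫ s in (0 : ℝ)..t, temperedIntegrand lam g x s

open Classical in
/-- The tempered generalized Hermite process `Z(t) = I_k(h_t)`; the fallback value `0` is used only
if `h_t` is not square integrable. -/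
def temperedHermiteZ (hW : IsWhiteNoise W P) (lam : ℝ) (g : (Fin k → ℝ) → ℝ) (t : ℝ) :
    Ω → ℝ :=
  if h : MemLp (temperedKernel lam g t) 2 (volume : Measure (Fin k → ℝ)) then
    (multipleIntegral hW k h.toLp : Lp ℝ 2 P)
  else 0

/-- `Y` is a continuous version of `X`: a process with `Y t = X t` almost surely for each `t`, all
of whose paths are continuous. -/
structure IsContinuousVersion (P : Measure Ω) (X Y : ℝ → Ω → ℝ) : Prop where
  measurable : ∀ t, Measurable (Y t)
  ae_eq : ∀ t, Y t =ᵐ[P] X t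
  continuous : ∀ ω, Continuous fun t => Y t ω

end

end TemperedHermite

end

/-!
The function `φ(y) = g(y) e^{-lam y}` on the positive orthant satisfies `h_t(x) = ∫₀ᵗ φ(s𝟏 - x) ds`.
Expanding the square and exchanging integrals, the second moment of `∫ |φ(s𝟏 - x)| ds` over an
interval reduces to the correlations `∫ |φ(y) φ(u𝟏 + y)| dy` with `u = |r - s|`. The substitution
`y = u z` and homogeneity bound them by `u^{2α + k} ∫ |g(z) g(𝟏 + z)| dz`, the exponentials being
at most `1` (`lintegral_temperedProfile_shift_le`); the last integral is finite by the integrability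
hypothesis at `u = 0`. As `2α + k > -1`, integrating over `r` and `s` in an interval of length `L`
gives a multiple of `L^{2α + k + 2} = L^{2H}` (`exists_lintegral_sq_le`). This yields the almost
everywhere absolute convergence, `h_t ∈ L²`, and `‖h_t - h_s‖² ≤ C |t - s|^{2H}`, which
`‖I_k f‖² ≤ k! ‖f‖²` carries over to the process.

Since `α > -(k + 1)/2`, the exponent `2H` exceeds `1`, so the Kolmogorov–Chentsov theorem gives a
continuous version; it is proved here for second moments on the line
(`exists_isContinuousVersion`). The dyadic increments of the process decay geometrically almost
surely, so its samples on the dyadic grids converge locally uniformly to a continuous limit; the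
same samples converge almost surely to the process at each fixed time.
-/

namespace TemperedHermite

/-! ### Continuous versions from a second moment bound -/

section

open Filter Topology

/-- The largest multiple of `2⁻ⁿ` that is at most `t`. -/
noncomputable def dyadicFloor (n : ℕ) (t : ℝ) : ℝ := ⌊2 ^ n * t⌋ / 2 ^ n

theorem abs_sub_dyadicFloor_le (n : ℕ) (t : ℝ) : |dyadicFloor n t - t| ≤ (2 ^ n)⁻¹ := by
  have h : (0 : ℝ) < 2 ^ n := by positivity
  have e : dyadicFloor n t - t = -Int.fract (2 ^ n * t) / 2 ^ n := by
    rw [dyadicFloor, Int.fract]; field_simp; ring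
  rw [e, abs_div, abs_neg, abs_of_pos h, abs_of_nonneg (Int.fract_nonneg _), ← one_div]
  gcongr
  exact (Int.fract_lt_one _).le

theorem abs_floor_two_pow_mul_le {N n : ℕ} {t : ℝ} (ht : |t| ≤ N) :
    |⌊2 ^ n * t⌋| ≤ (N * 2 ^ n : ℤ) := by
  have h : (0 : ℝ) < 2 ^ n := by positivity
  obtain ⟨h1, h2⟩ := abs_le.1 ht
  rw [abs_le]
  constructor
  · rw [Int.le_floor]; push_cast; nlinarith
  · have : (⌊2 ^ n * t⌋ : ℝ) ≤ N * 2 ^ n := (Int.floor_le _).trans (by nlinarith)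
    exact_mod_cast this

/-- The increments of `x` over dyadic intervals of length `2⁻ⁿ` are `O(ρⁿ)`, uniformly over the
intervals that meet a bounded set. -/
def DyadicDecay (ρ : ℝ) (x : ℝ → ℝ) : Prop :=
  ∀ N : ℕ, ∃ K, 0 ≤ K ∧ ∀ n : ℕ, ∀ j : ℤ, |j| ≤ N * 2 ^ n →
    |x ((j + 1) / 2 ^ n) - x (j / 2 ^ n)| ≤ K * ρ ^ n

/-- If the dyadic increments of `x` decay geometrically, then the step functions that sample `x` on
the dyadic grids converge, locally uniformly, to a continuous function. -/
theorem DyadicDecay.exists_continuous {ρ : ℝ} (h0 : 0 ≤ ρ) (h1 : ρ < 1) {x : ℝ → ℝ}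
    (hx : DyadicDecay ρ x) :
    ∃ y : ℝ → ℝ, Continuous y ∧
      ∀ t, Tendsto (fun n => x (dyadicFloor n t)) atTop (𝓝 (y t)) := by
  choose K hK0 hK using hx
  have step : ∀ (N : ℕ) (t : ℝ), |t| ≤ N → ∀ n,
      dist (x (dyadicFloor n t)) (x (dyadicFloor (n + 1) t)) ≤ K N * ρ ^ n := by
    intro N t ht n
    have hle : K N * ρ ^ (n + 1) ≤ K N * ρ ^ n :=
      mul_le_mul_of_nonneg_left (pow_le_pow_of_le_one h0 h1.le n.le_succ) (hK0 N)
    set m := ⌊2 ^ n * t⌋ with hm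
    have hb : |2 * m| ≤ (N * 2 ^ (n + 1) : ℤ) := by
      have := abs_floor_two_pow_mul_le (n := n) ht
      rw [← hm] at this
      rw [abs_mul, pow_succ, abs_two]
      linarith
    have e1 : dyadicFloor n t = ((2 * m : ℤ) : ℝ) / 2 ^ (n + 1) := by
      rw [dyadicFloor, ← hm, pow_succ]; push_cast; field_simp
    have hf : ⌊2 ^ (n + 1) * t⌋ = 2 * m ∨ ⌊2 ^ (n + 1) * t⌋ = 2 * m + 1 := by
      have l1 := Int.floor_le (2 ^ n * t)
      have l2 := Int.lt_floor_add_one (2 ^ n * t)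
      rw [← hm] at l1 l2
      have a1 : 2 * m ≤ ⌊2 ^ (n + 1) * t⌋ := by
        rw [Int.le_floor, pow_succ]; push_cast; linarith
      have a2 : ⌊2 ^ (n + 1) * t⌋ < 2 * m + 2 := by
        rw [Int.floor_lt, pow_succ]; push_cast; linarith
      omega
    rcases hf with hf | hf
    · rw [dyadicFloor.eq_def (n + 1), hf, e1, dist_self]
      exact mul_nonneg (hK0 N) (pow_nonneg h0 _)
    · rw [dyadicFloor.eq_def (n + 1), hf, e1, dist_comm, Real.dist_eq]
      refine le_trans ?_ hle
      simpa using hK N (n + 1) (2 * m) hb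
  have hlim : ∀ t, ∃ y, Tendsto (fun n => x (dyadicFloor n t)) atTop (𝓝 y) := by
    intro t
    obtain ⟨N, hN⟩ := exists_nat_ge |t|
    exact cauchySeq_tendsto_of_complete (cauchySeq_of_le_geometric ρ (K N) h1 (step N t hN))
  choose y hy using hlim
  refine ⟨y, ?_, hy⟩
  have happ : ∀ (N : ℕ) (t : ℝ), |t| ≤ N → ∀ n, dist (x (dyadicFloor n t)) (y t) ≤
      K N / (1 - ρ) * ρ ^ n := fun N t ht n =>
    (dist_le_of_le_geometric_of_tendsto ρ (K N) h1 (step N t ht) (hy t) n).trans_eq (by ring)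
  -- Points at distance less than `2⁻ⁿ` lie in equal or adjacent intervals of generation `n`.
  have hnear : ∀ (N : ℕ) (s t : ℝ), |s| ≤ N → |t| ≤ N → ∀ n, s ≤ t → t - s < (2 ^ n)⁻¹ →
      dist (x (dyadicFloor n t)) (x (dyadicFloor n s)) ≤ K N * ρ ^ n := by
    intro N s t hs ht n hst hlt
    have hp : (0 : ℝ) < 2 ^ n := by positivity
    have hlt' : 2 ^ n * t < 2 ^ n * s + 1 := by
      have := mul_lt_mul_of_pos_left hlt hp
      rw [mul_inv_cancel₀ hp.ne'] at this; linarith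
    have hf : ⌊2 ^ n * t⌋ = ⌊2 ^ n * s⌋ ∨ ⌊2 ^ n * t⌋ = ⌊2 ^ n * s⌋ + 1 := by
      have a1 : ⌊2 ^ n * s⌋ ≤ ⌊2 ^ n * t⌋ := Int.floor_mono (by gcongr)
      have a2 : ⌊2 ^ n * t⌋ < ⌊2 ^ n * s⌋ + 2 := by
        rw [Int.floor_lt]; push_cast; linarith [Int.lt_floor_add_one (2 ^ n * s)]
      omega
    rcases hf with hf | hf
    · rw [dyadicFloor, dyadicFloor, hf, dist_self]
      exact mul_nonneg (hK0 N) (pow_nonneg h0 _)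
    · rw [dyadicFloor, dyadicFloor, hf, Real.dist_eq]
      simpa using hK N n _ (abs_floor_two_pow_mul_le hs)
  rw [continuous_iff_continuousAt]
  intro t
  rw [Metric.continuousAt_iff]
  intro ε hε
  obtain ⟨N, hN⟩ := exists_nat_ge (|t| + 1)
  have hpow : Tendsto (fun n : ℕ => (2 * (K N / (1 - ρ)) + K N) * ρ ^ n) atTop (𝓝 0) := by
    simpa using (tendsto_pow_atTop_nhds_zero_of_lt_one h0 h1).const_mul
      (2 * (K N / (1 - ρ)) + K N)
  obtain ⟨n, hn⟩ := (hpow.eventually_lt_const hε).exists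
  refine ⟨(2 ^ n)⁻¹, by positivity, fun s hs => lt_of_le_of_lt ?_ hn⟩
  rw [Real.dist_eq] at hs
  have hle1 : ((2 : ℝ) ^ n)⁻¹ ≤ 1 := inv_le_one_of_one_le₀ (one_le_pow₀ (by norm_num))
  have htN : |t| ≤ N := by linarith
  have hsN : |s| ≤ N := by
    have := abs_add_le (s - t) t
    rw [sub_add_cancel] at this; linarith
  have hmid : dist (x (dyadicFloor n s)) (x (dyadicFloor n t)) ≤ K N * ρ ^ n := by
    rcases le_total s t with hst | hst
    · rw [dist_comm]
      rw [abs_sub_comm] at hs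
      exact hnear N s t hsN htN n hst ((le_abs_self _).trans_lt hs)
    · exact hnear N t s htN hsN n hst ((le_abs_self _).trans_lt hs)
  have t1 := happ N s hsN n
  have t2 := happ N t htN n
  have := dist_triangle4 (y s) (x (dyadicFloor n s)) (x (dyadicFloor n t)) (y t)
  rw [dist_comm (y s) (x _)] at this
  linarith

section

variable {Ω : Type*} [MeasurableSpace Ω] {P : Measure Ω} {X : ℝ → Ω → ℝ} {C q : ℝ}

theorem ae_tsum_lt_top {ι : Type*} [Countable ι] {F : ι → Ω → ℝ≥0∞} (hF : ∀ i, Measurable (F i))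
    {b : ι → ℝ≥0∞} (hb : ∀ i, ∫⁻ ω, F i ω ∂P ≤ b i) (hs : ∑' i, b i ≠ ∞) :
    ∀ᵐ ω ∂P, ∑' i, F i ω < ∞ := by
  refine ae_lt_top (Measurable.tsum hF) ?_
  rw [lintegral_tsum fun i => (hF i).aemeasurable]
  exact ne_top_of_le_ne_top hs (ENNReal.tsum_le_tsum hb)

theorem lintegral_ofReal_const_mul_le {f : Ω → ℝ} {a b : ℝ} (ha : 0 ≤ a)
    (h : ∫⁻ ω, ENNReal.ofReal (f ω) ∂P ≤ ENNReal.ofReal b) :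
    ∫⁻ ω, ENNReal.ofReal (a * f ω) ∂P ≤ ENNReal.ofReal (a * b) := by
  simp_rw [ENNReal.ofReal_mul ha]
  rw [lintegral_const_mul' _ _ ENNReal.ofReal_ne_top]
  gcongr

theorem ae_tendsto_dyadicFloor (hX : ∀ t, Measurable (X t)) (hC : 0 ≤ C) (hq : 1 < q)
    (h : ∀ s t, ∫⁻ ω, ENNReal.ofReal ((X t ω - X s ω) ^ 2) ∂P ≤ ENNReal.ofReal (C * |t - s| ^ q))
    (t : ℝ) : ∀ᵐ ω ∂P, Tendsto (fun n => X (dyadicFloor n t) ω) atTop (𝓝 (X t ω)) := by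
  have hb : ∀ n : ℕ, ∫⁻ ω, ENNReal.ofReal ((X (dyadicFloor n t) ω - X t ω) ^ 2) ∂P ≤
      ENNReal.ofReal (C * 2⁻¹ ^ n) := by
    intro n
    refine (h _ _).trans (ENNReal.ofReal_le_ofReal (mul_le_mul_of_nonneg_left ?_ hC))
    have h1 := abs_sub_dyadicFloor_le n t
    calc |dyadicFloor n t - t| ^ q ≤ ((2 ^ n)⁻¹ : ℝ) ^ q := by gcongr
      _ ≤ ((2 ^ n)⁻¹ : ℝ) ^ (1 : ℝ) := Real.rpow_le_rpow_of_exponent_ge (by positivity)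
          (inv_le_one_of_one_le₀ (one_le_pow₀ (by norm_num))) hq.le
      _ = 2⁻¹ ^ n := by rw [Real.rpow_one, inv_pow]
  have hs : Summable fun n : ℕ => C * (2⁻¹ : ℝ) ^ n :=
    (summable_geometric_of_lt_one (by norm_num) (by norm_num)).mul_left C
  filter_upwards [ae_tsum_lt_top (fun n => by have := hX; fun_prop) hb hs.tsum_ofReal_ne_top]
    with ω hω
  have h0 : Tendsto (fun n : ℕ => ENNReal.ofReal ((X (dyadicFloor n t) ω - X t ω) ^ 2)) atTop
      (𝓝 0) := by
    rw [← Nat.cofinite_eq_atTop]; exact ENNReal.tendsto_cofinite_zero_of_tsum_ne_top hω.ne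
  have h1 := (ENNReal.tendsto_toReal ENNReal.zero_ne_top).comp h0
  have h2 := (Real.continuous_sqrt.tendsto _).comp h1
  rw [tendsto_iff_dist_tendsto_zero]
  refine (h2.congr fun n => ?_).trans_eq (by simp)
  simp [ENNReal.toReal_ofReal (sq_nonneg _), Real.sqrt_sq_eq_abs, Real.dist_eq]

/-- There are `O(2ⁿ)` dyadic increments of generation `n`, each with second moment `O(2^{-nq})`.
So `2^{n(q-1)/2}` times the sum of their squares is still summable in `n` in expectation, hence
bounded almost surely, which gives the decay rate `2^{-(q-1)/4}`. -/
theorem ae_dyadicDecay (hX : ∀ t, Measurable (X t)) (hC : 0 ≤ C) (hq : 1 < q)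
    (h : ∀ s t, ∫⁻ ω, ENNReal.ofReal ((X t ω - X s ω) ^ 2) ∂P ≤
      ENNReal.ofReal (C * |t - s| ^ q)) :
    ∀ᵐ ω ∂P, DyadicDecay (2 ^ ((1 - q) / 4)) fun t => X t ω := by
  set ρ : ℝ := 2 ^ ((1 - q) / 4) with hρ
  have hρ0 : 0 < ρ := by positivity
  have hρ1 : ρ < 1 := Real.rpow_lt_one_of_one_lt_of_neg (by norm_num) (by linarith)
  have hρ4 : ∀ n : ℕ, 2 ^ n * ((2 ^ n)⁻¹ : ℝ) ^ q = (ρ ^ n) ^ 4 := by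
    intro n
    have hbase : 2 * (2⁻¹ : ℝ) ^ q = ρ ^ 4 := by
      rw [hρ, ← Real.rpow_natCast, ← Real.rpow_mul (by norm_num), Real.inv_rpow (by norm_num),
        ← Real.rpow_neg (by norm_num)]
      nth_rewrite 1 [← Real.rpow_one 2]
      rw [← Real.rpow_add (by norm_num)]
      congr 1; push_cast; ring
    rw [← inv_pow, ← Real.rpow_pow_comm (by norm_num), ← mul_pow, hbase, pow_right_comm]
  unfold DyadicDecay
  rw [ae_all_iff]
  intro N
  let J : ℕ → Finset ℤ := fun n => Finset.Icc (-(N * 2 ^ n)) (N * 2 ^ n)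
  let D : ℕ → ℤ → Ω → ℝ := fun n j ω => X ((j + 1) / 2 ^ n) ω - X (j / 2 ^ n) ω
  have hD : ∀ n j, Measurable (D n j) := fun n j => (hX _).sub (hX _)
  have hb : ∀ n : ℕ, ∫⁻ ω, ∑ j ∈ J n, ENNReal.ofReal (((ρ ^ n) ^ 2)⁻¹ * D n j ω ^ 2) ∂P ≤
      ENNReal.ofReal ((2 * N + 1) * C * (ρ ^ 2) ^ n) := by
    intro n
    have hp : (0 : ℝ) < 2 ^ n := by positivity
    rw [lintegral_finsetSum _ fun j _ => by have := hD n j; fun_prop]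
    have hj : ∀ j ∈ J n, ∫⁻ ω, ENNReal.ofReal (((ρ ^ n) ^ 2)⁻¹ * D n j ω ^ 2) ∂P ≤
        ENNReal.ofReal (((ρ ^ n) ^ 2)⁻¹ * (C * ((2 ^ n)⁻¹ : ℝ) ^ q)) := by
      intro j _
      refine lintegral_ofReal_const_mul_le (by positivity) ((h _ _).trans_eq ?_)
      rw [← sub_div, add_sub_cancel_left, one_div, abs_of_pos (by positivity)]
    refine (Finset.sum_le_sum hj).trans ?_
    have hcard : ((J n).card : ℝ) ≤ (2 * N + 1) * 2 ^ n := by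
      have e : ((J n).card : ℤ) = 2 * (N * 2 ^ n) + 1 := by
        simp only [J, Int.card_Icc]
        rw [Int.toNat_of_nonneg (by linarith [show (0 : ℤ) ≤ N * 2 ^ n by positivity])]; ring
      have e' : ((J n).card : ℝ) = 2 * (N * 2 ^ n) + 1 := by exact_mod_cast e
      have : (1 : ℝ) ≤ 2 ^ n := one_le_pow₀ (by norm_num)
      rw [e']; linarith
    rw [Finset.sum_const, nsmul_eq_mul, ← ENNReal.ofReal_natCast,
      ← ENNReal.ofReal_mul (by positivity)]
    refine ENNReal.ofReal_le_ofReal ?_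
    calc ((J n).card : ℝ) * (((ρ ^ n) ^ 2)⁻¹ * (C * ((2 ^ n)⁻¹ : ℝ) ^ q))
        ≤ ((2 * N + 1) * 2 ^ n) * (((ρ ^ n) ^ 2)⁻¹ * (C * ((2 ^ n)⁻¹ : ℝ) ^ q)) := by gcongr
      _ = (2 * N + 1) * C * (((ρ ^ n) ^ 2)⁻¹ * (2 ^ n * ((2 ^ n)⁻¹ : ℝ) ^ q)) := by ring
      _ = (2 * N + 1) * C * (ρ ^ 2) ^ n := by
        rw [hρ4, ← pow_mul ρ 2, mul_comm 2 n, pow_mul]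
        have : ρ ^ n ≠ 0 := by positivity
        field_simp
  have hs : Summable fun n : ℕ => (2 * N + 1) * C * (ρ ^ 2) ^ n :=
    (summable_geometric_of_lt_one (by positivity)
      (pow_lt_one₀ hρ0.le hρ1 two_ne_zero)).mul_left _
  have hm : ∀ n : ℕ, Measurable fun ω =>
      ∑ j ∈ J n, ENNReal.ofReal (((ρ ^ n) ^ 2)⁻¹ * D n j ω ^ 2) := fun n =>
    Finset.measurable_fun_sum _ fun j _ => by have := hD n j; fun_prop
  filter_upwards [ae_tsum_lt_top hm hb hs.tsum_ofReal_ne_top] with ω hω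
  refine ⟨√(∑' n : ℕ, ∑ j ∈ J n, ENNReal.ofReal (((ρ ^ n) ^ 2)⁻¹ * D n j ω ^ 2)).toReal,
    Real.sqrt_nonneg _, fun n j hj => ?_⟩
  have hjJ : j ∈ J n := Finset.mem_Icc.2 (abs_le.1 hj)
  have hle : ENNReal.ofReal (((ρ ^ n) ^ 2)⁻¹ * D n j ω ^ 2) ≤
      ∑' n : ℕ, ∑ j ∈ J n, ENNReal.ofReal (((ρ ^ n) ^ 2)⁻¹ * D n j ω ^ 2) :=
    (Finset.single_le_sum (f := fun j => ENNReal.ofReal (((ρ ^ n) ^ 2)⁻¹ * D n j ω ^ 2))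
      (fun _ _ => zero_le) hjJ).trans (ENNReal.le_tsum n)
  rw [ENNReal.ofReal_le_iff_le_toReal hω.ne] at hle
  have hpn : 0 < ρ ^ n := pow_pos hρ0 n
  rw [← div_le_iff₀ hpn]
  refine Real.le_sqrt_of_sq_le (le_trans (le_of_eq ?_) hle)
  rw [div_pow, sq_abs]; ring

/-- The **Kolmogorov–Chentsov theorem** on the line, for second moments. -/
theorem exists_isContinuousVersion (hX : ∀ t, Measurable (X t)) (hC : 0 ≤ C) (hq : 1 < q)
    (h : ∀ s t, ∫⁻ ω, ENNReal.ofReal ((X t ω - X s ω) ^ 2) ∂P ≤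
      ENNReal.ofReal (C * |t - s| ^ q)) :
    ∃ Y, IsContinuousVersion P X Y := by
  -- The samples are set to `0` on the measurable null set `B`, so that the limit exists everywhere.
  obtain ⟨B, hB, hBm, hB0⟩ := exists_measurable_superset_of_null (ae_dyadicDecay hX hC hq h)
  have hlim : ∀ ω, ∃ y : ℝ → ℝ, Continuous y ∧ ∀ t,
      Tendsto (fun n => Bᶜ.indicator (X (dyadicFloor n t)) ω) atTop (𝓝 (y t)) := by
    intro ω
    by_cases hω : ω ∈ B
    · exact ⟨0, continuous_zero, fun t => by simp [hω]⟩
    · have hd : DyadicDecay (2 ^ ((1 - q) / 4)) fun t => X t ω := by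
        by_contra hd; exact hω (hB hd)
      simpa [hω] using hd.exists_continuous (by positivity)
        (Real.rpow_lt_one_of_one_lt_of_neg (by norm_num) (by linarith))
  choose Y hYc hY using hlim
  refine ⟨fun t ω => Y ω t, ?_, ?_, hYc⟩
  · intro t
    exact measurable_of_tendsto_metrizable (fun n => (hX _).indicator hBm.compl)
      (tendsto_pi_nhds.2 fun ω => hY ω t)
  · intro t
    have hBae : ∀ᵐ ω ∂P, ω ∉ B := measure_eq_zero_iff_ae_notMem.1 hB0
    filter_upwards [ae_tendsto_dyadicFloor hX hC hq h t, hBae] with ω h1 h2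
    refine tendsto_nhds_unique (hY ω t) ?_
    simpa [h2] using h1

end

end

/-! ### Moments of the tempered kernel -/

section

variable {k : ℕ} {α lam : ℝ} {g : (Fin k → ℝ) → ℝ}

/-- The function `y ↦ g(y) e^{-lam y}`, extended by `0` outside the positive orthant. -/
noncomputable def temperedProfile (lam : ℝ) (g : (Fin k → ℝ) → ℝ) (y : Fin k → ℝ) : ℝ :=
  (positiveOrthant k).indicator g y * ∏ i, Real.exp (-lam * y i)

theorem temperedIntegrand_eq (lam : ℝ) (g : (Fin k → ℝ) → ℝ) (x : Fin k → ℝ) (s : ℝ) :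
    temperedIntegrand lam g x s = temperedProfile lam g (fun i => s - x i) := by
  by_cases h : ∀ i, x i < s
  · simp [temperedIntegrand, temperedProfile, positiveOrthant, indicator, h]
  · simp [temperedIntegrand, temperedProfile, positiveOrthant, indicator, h]

theorem measurableSet_positiveOrthant (k : ℕ) : MeasurableSet (positiveOrthant k) := by
  have : positiveOrthant k = ⋂ i, {x | 0 < x i} := by ext; simp [positiveOrthant]
  rw [this]
  exact MeasurableSet.iInter fun i => measurableSet_lt measurable_const (measurable_pi_apply i)

namespace IsTemperedHermiteKernel

theorem measurable_temperedProfile (hg : IsTemperedHermiteKernel α lam g) :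
    Measurable (temperedProfile lam g) := by
  classical
  have e : (positiveOrthant k).indicator g =
      Function.extend Subtype.val ((positiveOrthant k).domRestrict g) 0 := by
    ext x
    by_cases hx : x ∈ positiveOrthant k
    · rw [indicator_of_mem hx]
      exact (Subtype.val_injective.extend_apply ((positiveOrthant k).domRestrict g) 0 ⟨x, hx⟩).symm
    · rw [indicator_of_notMem hx, Function.extend_apply' _ _ _ (by rintro ⟨a, rfl⟩; exact hx a.2)]
      rfl
  have h : Measurable ((positiveOrthant k).indicator g) := e ▸
    (MeasurableEmbedding.subtype_coe (measurableSet_positiveOrthant k)).measurable_extend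
      hg.measurable measurable_zero
  exact h.mul (by fun_prop)

theorem measurable_uncurry_temperedIntegrand (hg : IsTemperedHermiteKernel α lam g) :
    Measurable (Function.uncurry (temperedIntegrand lam g)) := by
  have e : Function.uncurry (temperedIntegrand lam g) =
      fun p : (Fin k → ℝ) × ℝ => temperedProfile lam g (fun i => p.2 - p.1 i) :=
    funext fun p => temperedIntegrand_eq lam g p.1 p.2
  rw [e]
  exact hg.measurable_temperedProfile.comp (by fun_prop)

theorem lintegral_mul_shift_ne_top (hg : IsTemperedHermiteKernel α lam g) :
    ∫⁻ x in positiveOrthant k, ‖g x‖ₑ * ‖g (1 + x)‖ₑ ≠ ∞ := by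
  have h := (hg.integrable 0 le_rfl).2
  simpa [HasFiniteIntegral, enorm_mul] using h.ne

theorem enorm_temperedProfile_smul_le (hg : IsTemperedHermiteKernel α lam g) (hlam : 0 ≤ lam)
    {c : ℝ} (hc : 0 < c) {x : Fin k → ℝ} (hx : x ∈ positiveOrthant k) :
    ‖temperedProfile lam g (c • x)‖ₑ ≤ ENNReal.ofReal (c ^ α) * ‖g x‖ₑ := by
  have hcx : c • x ∈ positiveOrthant k := fun i => mul_pos hc (hx i)
  have hexp : ∏ i, Real.exp (-lam * (c • x) i) ≤ 1 :=
    Finset.prod_le_one (fun _ _ => (Real.exp_pos _).le) fun i _ =>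
      Real.exp_le_one_iff.2 (by nlinarith [hcx i, mul_nonneg hlam (hcx i).le])
  have hexp0 : 0 ≤ ∏ i, Real.exp (-lam * (c • x) i) :=
    Finset.prod_nonneg fun _ _ => (Real.exp_pos _).le
  rw [temperedProfile, indicator_of_mem hcx, hg.homogeneous c hc x hx, enorm_mul, enorm_mul,
    Real.enorm_of_nonneg (by positivity : 0 ≤ c ^ α), Real.enorm_of_nonneg hexp0]
  exact mul_le_of_le_one_right' (ENNReal.ofReal_le_one.2 hexp)

/-- Rescaling by `u` reduces the correlation of the profile at lag `u` to lag `1`; the exponential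
factors only help. -/
theorem lintegral_temperedProfile_shift_le (hg : IsTemperedHermiteKernel α lam g)
    (hlam : 0 ≤ lam) {u : ℝ} (hu : 0 < u) :
    ∫⁻ y, ‖temperedProfile lam g y‖ₑ * ‖temperedProfile lam g (fun i => u + y i)‖ₑ ≤
      ENNReal.ofReal (u ^ (2 * α + k)) *
        ∫⁻ x in positiveOrthant k, ‖g x‖ₑ * ‖g (1 + x)‖ₑ := by
  have hφ := hg.measurable_temperedProfile
  set F : (Fin k → ℝ) → ℝ≥0∞ := fun y =>
    ‖temperedProfile lam g y‖ₑ * ‖temperedProfile lam g (fun i => u + y i)‖ₑ with hF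
  have hFm : Measurable F := hφ.enorm.mul (hφ.comp (by fun_prop)).enorm
  have hscale : ∫⁻ y, F y = ENNReal.ofReal (u ^ k) * ∫⁻ x, F (u • x) := by
    rw [← lintegral_map hFm (measurable_const_smul u), Measure.map_addHaar_smul _ hu.ne',
      lintegral_smul_measure, smul_eq_mul, ← mul_assoc, ← ENNReal.ofReal_mul (by positivity),
      Module.finrank_fin_fun, abs_of_pos (by positivity), mul_inv_cancel₀ (by positivity),
      ENNReal.ofReal_one, one_mul]
  have hpt : ∀ x, F (u • x) ≤ ENNReal.ofReal (u ^ (2 * α)) *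
      (positiveOrthant k).indicator (fun x => ‖g x‖ₑ * ‖g (1 + x)‖ₑ) x := by
    intro x
    by_cases hx : x ∈ positiveOrthant k
    · have hx1 : 1 + x ∈ positiveOrthant k := fun i => add_pos one_pos (hx i)
      have e : (fun i => u + (u • x) i) = u • (1 + x) := by ext i; simp [mul_add]
      simp only [hF, e, indicator_of_mem hx]
      refine (mul_le_mul' (hg.enorm_temperedProfile_smul_le hlam hu hx)
        (hg.enorm_temperedProfile_smul_le hlam hu hx1)).trans_eq ?_
      rw [two_mul, Real.rpow_add hu, ENNReal.ofReal_mul (by positivity)]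
      ring
    · have hux : u • x ∉ positiveOrthant k := fun h =>
        hx fun i => (mul_pos_iff_of_pos_left hu).1 (h i)
      simp [hF, temperedProfile, hux]
  rw [hscale, Real.rpow_add hu, Real.rpow_natCast, mul_comm (u ^ _),
    ENNReal.ofReal_mul (by positivity), mul_assoc]
  gcongr
  refine (lintegral_mono hpt).trans_eq ?_
  rw [lintegral_const_mul' _ _ ENNReal.ofReal_ne_top,
    lintegral_indicator (measurableSet_positiveOrthant k)]

theorem lintegral_temperedIntegrand_mul_le (hg : IsTemperedHermiteKernel α lam g)
    (hlam : 0 ≤ lam) {s r : ℝ} (hsr : s ≠ r) :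
    ∫⁻ x, ‖temperedIntegrand lam g x s‖ₑ * ‖temperedIntegrand lam g x r‖ₑ ≤
      ENNReal.ofReal (|r - s| ^ (2 * α + k)) *
        ∫⁻ x in positiveOrthant k, ‖g x‖ₑ * ‖g (1 + x)‖ₑ := by
  wlog h : s < r generalizing s r
  · rw [abs_sub_comm]
    simp_rw [mul_comm ‖temperedIntegrand lam g _ s‖ₑ]
    exact this hsr.symm (lt_of_le_of_ne (not_lt.1 h) hsr.symm)
  rw [abs_of_pos (sub_pos.2 h)]
  refine le_trans (le_of_eq ?_) (hg.lintegral_temperedProfile_shift_le hlam (sub_pos.2 h))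
  refine Eq.trans ?_ (lintegral_sub_left_eq_self _ (fun _ : Fin k => s))
  refine lintegral_congr fun x => ?_
  rw [temperedIntegrand_eq, temperedIntegrand_eq]
  congr 3
  ext i
  simp

end IsTemperedHermiteKernel

theorem lintegral_abs_sub_rpow_le {γ a b s : ℝ} (hγ : -1 < γ) (hs : s ∈ Ioc a b) :
    ∫⁻ r in Ioc a b, ENNReal.ofReal (|r - s| ^ γ) ≤
      ENNReal.ofReal (2 * ((b - a) ^ (γ + 1) / (γ + 1))) := by
  have hab : 0 ≤ b - a := by linarith [hs.1, hs.2]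
  -- Extending `v ^ γ` by zero makes the bound translation invariant, hence independent of `s`.
  let H : ℝ → ℝ≥0∞ := (Icc 0 (b - a)).indicator fun v => ENNReal.ofReal (v ^ γ)
  have hH : Measurable H := Measurable.indicator (by fun_prop) measurableSet_Icc
  have hHint : ∫⁻ v, H v = ENNReal.ofReal ((b - a) ^ (γ + 1) / (γ + 1)) := by
    have hi := intervalIntegral.intervalIntegrable_rpow' (a := 0) (b := b - a) hγ
    rw [intervalIntegrable_iff, uIoc_of_le hab] at hi
    rw [lintegral_indicator measurableSet_Icc, ← restrict_Ioc_eq_restrict_Icc,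
      ← ofReal_integral_eq_lintegral_ofReal hi, ← intervalIntegral.integral_of_le hab,
      integral_rpow (Or.inl hγ), Real.zero_rpow (by linarith), sub_zero]
    filter_upwards [ae_restrict_mem measurableSet_Ioc] with v hv
    exact Real.rpow_nonneg hv.1.le _
  calc ∫⁻ r in Ioc a b, ENNReal.ofReal (|r - s| ^ γ)
      = ∫⁻ r in Ioc a b, H |r - s| := by
        refine setLIntegral_congr_fun measurableSet_Ioc fun r hr => ?_
        have : |r - s| ∈ Icc 0 (b - a) :=
          ⟨abs_nonneg _, abs_le.2 ⟨by linarith [hr.1, hs.2], by linarith [hr.2, hs.1]⟩⟩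
        simp only [H, indicator_of_mem this]
    _ ≤ ∫⁻ r, H |r - s| := setLIntegral_le_lintegral _ _
    _ = ∫⁻ v, H |v| := lintegral_sub_right_eq_self (fun v => H |v|) s
    _ ≤ ∫⁻ v, (H v + H (-v)) := by
        refine lintegral_mono fun v => ?_
        rcases abs_choice v with h | h
        · simp only [h]; exact le_self_add
        · simp only [h]; exact le_add_self
    _ = ENNReal.ofReal (2 * ((b - a) ^ (γ + 1) / (γ + 1))) := by
        rw [lintegral_add_left hH, lintegral_neg_eq_self (fun v => H v), hHint, ← two_mul,
          ENNReal.ofReal_mul zero_le_two, ENNReal.ofReal_ofNat]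

theorem lintegral_sq_lintegral_eq {β : Type*} [MeasurableSpace β] {μ : Measure β} [SFinite μ]
    {τ : Type*} [MeasurableSpace τ] {ν : Measure τ} [SFinite ν] {f : β → τ → ℝ≥0∞}
    (hf : Measurable (Function.uncurry f)) :
    ∫⁻ x, (∫⁻ s, f x s ∂ν) ^ 2 ∂μ = ∫⁻ s, ∫⁻ r, ∫⁻ x, f x s * f x r ∂μ ∂ν ∂ν := by
  have hx : ∀ x, Measurable (f x) := fun x => hf.of_uncurry_left
  calc ∫⁻ x, (∫⁻ s, f x s ∂ν) ^ 2 ∂μ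
      = ∫⁻ x, ∫⁻ s, ∫⁻ r, f x s * f x r ∂ν ∂ν ∂μ := by
        refine lintegral_congr fun x => ?_
        rw [sq, lintegral_lintegral_mul (hx x).aemeasurable (hx x).aemeasurable]
    _ = ∫⁻ s, ∫⁻ x, ∫⁻ r, f x s * f x r ∂ν ∂μ ∂ν := by
        refine lintegral_lintegral_swap (Measurable.aemeasurable ?_)
        refine Measurable.lintegral_prod_right'
          (f := fun p : (β × τ) × τ => f p.1.1 p.1.2 * f p.1.1 p.2) ?_
        exact (hf.comp measurable_fst).mul
          (hf.comp (g := Function.uncurry f)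
            ((measurable_fst.comp measurable_fst).prodMk measurable_snd))
    _ = ∫⁻ s, ∫⁻ r, ∫⁻ x, f x s * f x r ∂μ ∂ν ∂ν := by
        refine lintegral_congr fun s => lintegral_lintegral_swap (Measurable.aemeasurable ?_)
        exact (hf.comp (g := Function.uncurry f) (measurable_fst.prodMk measurable_const)).mul hf

/-- The second moment of `∫ |g(s𝟏 - x)| e^{-lam(s𝟏 - x)} ds` over an interval of length `L` is a
double integral of a correlation of order `|r - s|^{2α + k}`, which is integrable because
`2α + k > -1`, and hence is of order `L^{2α + k + 2}`. -/
theorem IsTemperedHermiteKernel.exists_lintegral_sq_le (hg : IsTemperedHermiteKernel α lam g)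
    (hlam : 0 ≤ lam) :
    ∃ C, 0 ≤ C ∧ ∀ a b, ∫⁻ x, (∫⁻ s in uIoc a b, ‖temperedIntegrand lam g x s‖ₑ) ^ 2 ≤
      ENNReal.ofReal (C * |b - a| ^ (2 * (α + 1 + (k : ℝ) / 2))) := by
  set C₀ := ∫⁻ x in positiveOrthant k, ‖g x‖ₑ * ‖g (1 + x)‖ₑ with hC₀
  have hC₀top : C₀ ≠ ∞ := hg.lintegral_mul_shift_ne_top
  set γ := 2 * α + k with hγdef
  have hγ : -1 < γ := by have := hg.alpha_mem.1; rw [hγdef]; linarith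
  refine ⟨2 / (γ + 1) * C₀.toReal,
    mul_nonneg (div_nonneg zero_le_two (by linarith)) ENNReal.toReal_nonneg, fun a b => ?_⟩
  wlog hab : a ≤ b generalizing a b
  · rw [uIoc_comm, abs_sub_comm]
    exact this b a (le_of_not_ge hab)
  rw [uIoc_of_le hab, abs_of_nonneg (sub_nonneg.2 hab),
    lintegral_sq_lintegral_eq (f := fun x s => ‖temperedIntegrand lam g x s‖ₑ)
      hg.measurable_uncurry_temperedIntegrand.enorm]
  have hin : ∀ s ∈ Ioc a b, ∫⁻ r in Ioc a b, ∫⁻ x,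
      ‖temperedIntegrand lam g x s‖ₑ * ‖temperedIntegrand lam g x r‖ₑ ≤
        ENNReal.ofReal (2 * ((b - a) ^ (γ + 1) / (γ + 1))) * C₀ := by
    intro s hs
    -- The correlation bound is only available off the diagonal, because `0 ^ γ = 0` for `γ < 0`.
    have hne : ∀ᵐ r ∂volume.restrict (Ioc a b), s ≠ r :=
      ae_restrict_of_ae ((countable_singleton s).ae_notMem volume |>.mono fun r hr e => hr e.symm)
    calc _ ≤ ∫⁻ r in Ioc a b, ENNReal.ofReal (|r - s| ^ γ) * C₀ :=
          lintegral_mono_ae (hne.mono fun r hr => hg.lintegral_temperedIntegrand_mul_le hlam hr)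
      _ = (∫⁻ r in Ioc a b, ENNReal.ofReal (|r - s| ^ γ)) * C₀ :=
          lintegral_mul_const' _ _ hC₀top
      _ ≤ _ := by gcongr; exact lintegral_abs_sub_rpow_le hγ hs
  refine (setLIntegral_mono measurable_const hin).trans_eq ?_
  have hL : 0 ≤ b - a := sub_nonneg.2 hab
  have hγ1 : 0 < γ + 1 := by linarith
  have e : 2 * (α + 1 + (k : ℝ) / 2) = γ + 1 + 1 := by rw [hγdef]; ring
  rw [setLIntegral_const, Real.volume_Ioc, e, Real.rpow_add_one' (y := γ + 1) hL (by linarith),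
    ← ENNReal.ofReal_toReal hC₀top, ← ENNReal.ofReal_mul (by positivity),
    ← ENNReal.ofReal_mul (by positivity), ENNReal.toReal_ofReal ENNReal.toReal_nonneg]
  congr 1
  ring

end

/-! ### The process -/

section

variable {k : ℕ} {α lam : ℝ} {g : (Fin k → ℝ) → ℝ}

namespace IsTemperedHermiteKernel

theorem ae_intervalIntegrable (hg : IsTemperedHermiteKernel α lam g) (hlam : 0 ≤ lam) (a b : ℝ) :
    ∀ᵐ x, IntervalIntegrable (temperedIntegrand lam g x) volume a b := by
  obtain ⟨C, -, hC⟩ := hg.exists_lintegral_sq_le hlam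
  have hm := hg.measurable_uncurry_temperedIntegrand
  have h1 := ae_lt_top (hm.enorm.lintegral_prod_right'.pow_const 2)
    ((hC a b).trans_lt ENNReal.ofReal_lt_top).ne
  filter_upwards [h1] with x hx
  rw [intervalIntegrable_iff]
  refine ⟨(hm.of_uncurry_left (x := x)).aestronglyMeasurable, ?_⟩
  exact (ENNReal.pow_lt_top_iff.1 hx).resolve_right two_ne_zero

theorem stronglyMeasurable_temperedKernel (hg : IsTemperedHermiteKernel α lam g) (t : ℝ) :
    StronglyMeasurable (temperedKernel lam g t) := by
  have hm := hg.measurable_uncurry_temperedIntegrand.stronglyMeasurable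
  exact (hm.integral_prod_right (ν := volume.restrict (Ioc 0 t))).sub
    (hm.integral_prod_right (ν := volume.restrict (Ioc t 0)))

theorem temperedKernel_sub_ae_eq (hg : IsTemperedHermiteKernel α lam g) (hlam : 0 ≤ lam)
    (s t : ℝ) : (temperedKernel lam g t - temperedKernel lam g s) =ᵐ[volume]
      fun x => ∫ r in s..t, temperedIntegrand lam g x r := by
  filter_upwards [hg.ae_intervalIntegrable hlam 0 s, hg.ae_intervalIntegrable hlam 0 t]
    with x hs ht
  exact intervalIntegral.integral_interval_sub_left ht hs

theorem exists_eLpNorm_sub_sq_le (hg : IsTemperedHermiteKernel α lam g) (hlam : 0 ≤ lam) :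
    ∃ C, 0 ≤ C ∧ ∀ s t, eLpNorm (temperedKernel lam g t - temperedKernel lam g s) 2 volume ^ 2 ≤
      ENNReal.ofReal (C * |t - s| ^ (2 * (α + 1 + (k : ℝ) / 2))) := by
  obtain ⟨C, hC0, hC⟩ := hg.exists_lintegral_sq_le hlam
  refine ⟨C, hC0, fun s t => le_trans ?_ (hC s t)⟩
  have e := eLpNorm_nnreal_pow_eq_lintegral (μ := (volume : Measure (Fin k → ℝ)))
    (f := temperedKernel lam g t - temperedKernel lam g s) (p := 2) two_ne_zero
  simp only [NNReal.coe_ofNat, ENNReal.coe_ofNat, ENNReal.rpow_ofNat] at e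
  rw [e]
  refine lintegral_mono_ae ?_
  filter_upwards [hg.temperedKernel_sub_ae_eq hlam s t] with x hx
  rw [hx, ← Real.enorm_abs, intervalIntegral.abs_integral_eq_abs_integral_uIoc, Real.enorm_abs]
  gcongr
  exact enorm_integral_le_lintegral_enorm _

theorem memLp_temperedKernel (hg : IsTemperedHermiteKernel α lam g) (hlam : 0 ≤ lam) (t : ℝ) :
    MemLp (temperedKernel lam g t) 2 (volume : Measure (Fin k → ℝ)) := by
  obtain ⟨C, -, hC⟩ := hg.exists_eLpNorm_sub_sq_le hlam
  have h0 : temperedKernel lam g 0 = 0 := by ext; simp [temperedKernel]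
  have h := (hC 0 t).trans_lt ENNReal.ofReal_lt_top
  rw [h0, sub_zero] at h
  exact ⟨(hg.stronglyMeasurable_temperedKernel t).aestronglyMeasurable,
    (ENNReal.pow_lt_top_iff.1 h).resolve_right two_ne_zero⟩

variable {Ω : Type*} [MeasurableSpace Ω] {P : Measure Ω}
  {W : Lp ℝ 2 (volume : Measure ℝ) → Ω → ℝ}

theorem temperedHermiteZ_eq (hg : IsTemperedHermiteKernel α lam g) (hlam : 0 ≤ lam)
    (hW : IsWhiteNoise W P) (t : ℝ) : temperedHermiteZ hW lam g t =
      (multipleIntegral hW k (hg.memLp_temperedKernel hlam t).toLp : Lp ℝ 2 P) := by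
  rw [temperedHermiteZ, dif_pos (hg.memLp_temperedKernel hlam t)]

theorem measurable_temperedHermiteZ (hg : IsTemperedHermiteKernel α lam g) (hlam : 0 ≤ lam)
    (hW : IsWhiteNoise W P) (t : ℝ) : Measurable (temperedHermiteZ hW lam g t) := by
  rw [hg.temperedHermiteZ_eq hlam hW]
  exact (Lp.stronglyMeasurable _).measurable

/-- The `L²` bound for the kernels passes to the process because `‖I_k f‖² ≤ k! ‖f‖²`. -/
theorem exists_lintegral_temperedHermiteZ_sub_sq_le (hg : IsTemperedHermiteKernel α lam g)
    (hlam : 0 ≤ lam) (hW : IsWhiteNoise W P) :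
    ∃ C, 0 ≤ C ∧ ∀ s t, ∫⁻ ω, ENNReal.ofReal
      ((temperedHermiteZ hW lam g t ω - temperedHermiteZ hW lam g s ω) ^ 2) ∂P ≤
        ENNReal.ofReal (C * |t - s| ^ (2 * (α + 1 + (k : ℝ) / 2))) := by
  obtain ⟨C, hC0, hC⟩ := hg.exists_eLpNorm_sub_sq_le hlam
  refine ⟨k.factorial * C, by positivity, fun s t => ?_⟩
  have hs := hg.memLp_temperedKernel hlam s
  have ht := hg.memLp_temperedKernel hlam t
  have hsub : multipleIntegral hW k ht.toLp - multipleIntegral hW k hs.toLp =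
      multipleIntegral hW k (ht.sub hs).toLp := by rw [MemLp.toLp_sub, map_sub]
  have e := eLpNorm_nnreal_pow_eq_lintegral (μ := P) (p := 2) two_ne_zero
    (f := temperedHermiteZ hW lam g t - temperedHermiteZ hW lam g s)
  simp only [NNReal.coe_ofNat, ENNReal.coe_ofNat, ENNReal.rpow_ofNat, Pi.sub_apply] at e
  have e' : ∫⁻ ω, ENNReal.ofReal
      ((temperedHermiteZ hW lam g t ω - temperedHermiteZ hW lam g s ω) ^ 2) ∂P =
      eLpNorm (temperedHermiteZ hW lam g t - temperedHermiteZ hW lam g s) 2 P ^ 2 := by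
    rw [e]
    refine lintegral_congr fun ω => ?_
    rw [← sq_abs, ENNReal.ofReal_pow (abs_nonneg _), Real.enorm_eq_ofReal_abs]
  rw [e', hg.temperedHermiteZ_eq hlam hW, hg.temperedHermiteZ_eq hlam hW,
    ← eLpNorm_congr_ae (Lp.coeFn_sub _ _), hsub, ← Lp.enorm_def, ← ofReal_norm,
    ← ENNReal.ofReal_pow (norm_nonneg _)]
  refine ENNReal.ofReal_le_ofReal ?_
  have hk := norm_multipleIntegral_le hW (ht.sub hs).toLp
  have hn : ‖(ht.sub hs).toLp‖ ^ 2 ≤ C * |t - s| ^ (2 * (α + 1 + (k : ℝ) / 2)) := by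
    rw [Lp.norm_toLp, ← ENNReal.toReal_pow]
    exact ENNReal.toReal_le_of_le_ofReal (by positivity) (hC s t)
  calc ‖multipleIntegral hW k (ht.sub hs).toLp‖ ^ 2
      ≤ (√(k.factorial) * ‖(ht.sub hs).toLp‖) ^ 2 := by gcongr
    _ = k.factorial * ‖(ht.sub hs).toLp‖ ^ 2 := by rw [mul_pow, Real.sq_sqrt (by positivity)]
    _ ≤ k.factorial * (C * |t - s| ^ (2 * (α + 1 + (k : ℝ) / 2))) := by gcongr
    _ = k.factorial * C * |t - s| ^ (2 * (α + 1 + (k : ℝ) / 2)) := by ring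

end IsTemperedHermiteKernel

end

end TemperedHermite

theorem lemma3p3 {Ω : Type*} [MeasurableSpace Ω] {P : Measure Ω} [IsProbabilityMeasure P]
    {W : Lp ℝ 2 (volume : Measure ℝ) → Ω → ℝ} (hW : TemperedHermite.IsWhiteNoise W P)
    {k : ℕ} (hk : 1 ≤ k) {α lam : ℝ} (hlam : 0 < lam) {g : (Fin k → ℝ) → ℝ}
    (hg : TemperedHermite.IsTemperedHermiteKernel α lam g) :
    (∀ t : ℝ,
      (∀ᵐ x : Fin k → ℝ,
        IntervalIntegrable (TemperedHermite.temperedIntegrand lam g x) volume 0 t) ∧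
      MemLp (TemperedHermite.temperedKernel lam g t) 2 (volume : Measure (Fin k → ℝ))) ∧
    (∃ C : ℝ, ∀ s t : ℝ,
      ∫ ω, |TemperedHermite.temperedHermiteZ hW lam g t ω
          - TemperedHermite.temperedHermiteZ hW lam g s ω| ^ 2 ∂P
        ≤ C * |t - s| ^ (2 * (α + 1 + (k : ℝ) / 2))) ∧
    ∃ Y : ℝ → Ω → ℝ, TemperedHermite.IsContinuousVersion P
      (TemperedHermite.temperedHermiteZ hW lam g) Y := by

  obtain ⟨C, hC0, hC⟩ := hg.exists_lintegral_temperedHermiteZ_sub_sq_le hlam.le hW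
  have hZ := hg.measurable_temperedHermiteZ hlam.le hW
  refine ⟨fun t => ⟨hg.ae_intervalIntegrable hlam.le 0 t, hg.memLp_temperedKernel hlam.le t⟩,
    ⟨C, fun s t => ?_⟩,
    TemperedHermite.exists_isContinuousVersion hZ hC0 (by linarith [hg.alpha_mem.1]) hC⟩
  simp_rw [sq_abs]
  rw [integral_eq_lintegral_of_nonneg_ae (Filter.Eventually.of_forall fun ω => sq_nonneg _)
    (by exact (((hZ t).sub (hZ s)).pow_const 2).aestronglyMeasurable)]
  exact ENNReal.toReal_le_of_le_ofReal (by positivity) (hC s t)
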